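/- For an integer $n\ge 1$, let $Q_n$ be the $n\times n\times n$ grid with all non-decreasing diagonals: its vertex set is $\{(x,y,z)\in\mathbb{Z}^3 : 0\le x,y,z\le n-1\}$, and two distinct vertices are adjacent if and only if one can name them $(x,y,z)$ and $(x',y',z')$ so that $x\le x'\le x+1$, $y\le y'\le y+1$ and $z\le z'\le z+1$. For a set $A$ of vertices, $Q_n[A]$ denotes the subgraph of $Q_n$ induced by $A$. A tree decomposition of a finite graph $G$ consists of a finite tree $T$ and a bag $\beta(u)\subseteq V(G)$ for each vertex $u$ of $T$, such that every vertex of $G$, as well as both ends of every edge of $G$, are contained in some bag, and such that for every $v\in V(G)$ the set $\{u : v\in\beta(u)\}$ induces a connected subtree of $T$. Its width is the maximum size of a bag minus one, and the tree-width of $G$ is the minimum width of a tree decomposition of $G$ (so the graph without vertices has tree-width $-1$). Theorem. For every integer $t\ge 0$ there exists an integer $n\ge 1$ such that, for every partition of $V(Q_n)$ into two (possibly empty) sets $A_1$ and $A_2$, at least one of $Q_n[A_1]$ and $Q_n[A_2]$ has tree-width at least $t$. -/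

import Mathlib

/-- The monotone unit step relation on the triples `(x, y, z)` with `0 ≤ x, y, z ≤ n - 1`:
`x ≤ x' ≤ x + 1`, `y ≤ y' ≤ y + 1` and `z ≤ z' ≤ z + 1`. -/
def cubeStep (n : ℕ) (p q : Fin n × Fin n × Fin n) : Prop :=
  ((p.1 : ℕ) ≤ q.1 ∧ (q.1 : ℕ) ≤ p.1 + 1) ∧
  ((p.2.1 : ℕ) ≤ q.2.1 ∧ (q.2.1 : ℕ) ≤ p.2.1 + 1) ∧
  ((p.2.2 : ℕ) ≤ q.2.2 ∧ (q.2.2 : ℕ) ≤ p.2.2 + 1)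

/-- The graph `Q_n`: the `n × n × n` grid with all non-decreasing diagonals. Two distinct vertices
are adjacent iff one is obtained from the other by a monotone unit step. -/
def cubeGraph (n : ℕ) : SimpleGraph (Fin n × Fin n × Fin n) where
  Adj p q := p ≠ q ∧ (cubeStep n p q ∨ cubeStep n q p)
  symm := ⟨fun _ _ h => ⟨h.1.symm, h.2.symm⟩⟩
  loopless := ⟨fun _ h => h.1 rfl⟩

namespace SimpleGraph

/-- A tree decomposition of `G` whose tree has vertex set `ι`. (`Connected` includes
non-emptiness.) -/
structure TreeDecomposition {V : Type*} (G : SimpleGraph V) (ι : Type*) where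
  /-- the underlying tree -/
  tree : SimpleGraph ι
  isTree : tree.IsTree
  /-- the bag of each vertex of the tree -/
  bag : ι → Finset V
  vertex_mem : ∀ v : V, ∃ i, v ∈ bag i
  edge_mem : ∀ v w : V, G.Adj v w → ∃ i, v ∈ bag i ∧ w ∈ bag i
  connected : ∀ v : V, (tree.induce {i | v ∈ bag i}).Connected

/-- The width of a tree decomposition over a finite tree: maximum size of a bag, minus one. -/
def TreeDecomposition.width {V : Type*} {G : SimpleGraph V} {ι : Type*} [Fintype ι]
    (D : G.TreeDecomposition ι) : ℤ :=
  ((Finset.univ.sup fun i => (D.bag i).card : ℕ) : ℤ) - 1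

/-- The tree-width of a finite graph: the minimum width of its tree decompositions (it is `-1`
for the graph without vertices). -/
noncomputable def treewidth {V : Type*} [Finite V] (G : SimpleGraph V) : ℤ :=
  sInf {w : ℤ | ∃ (ι : Type) (_ : Fintype ι) (D : G.TreeDecomposition ι), D.width = w}

/-- The infimum defining the tree-width is attained. -/
theorem exists_width_eq_treewidth {V : Type*} [Finite V] (G : SimpleGraph V) :
    ∃ (ι : Type) (_ : Fintype ι) (D : G.TreeDecomposition ι), D.width = G.treewidth := by
  classical
  have := Fintype.ofFinite V
  refine Int.csInf_mem (s := {w : ℤ | ∃ (ι : Type) (_ : Fintype ι)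
    (D : G.TreeDecomposition ι), D.width = w}) ?_ ?_
  · refine ⟨_, Unit, inferInstance, ⟨⊥, ?_, fun _ => Finset.univ, ?_, ?_, ?_⟩, rfl⟩
    · exact IsTree.of_subsingleton
    · exact fun v => ⟨(), Finset.mem_univ v⟩
    · exact fun v w _ => ⟨(), Finset.mem_univ v, Finset.mem_univ w⟩
    · intro v
      have : Nonempty {i : Unit | v ∈ (Finset.univ : Finset V)} := ⟨⟨(), Finset.mem_univ v⟩⟩
      exact ⟨Preconnected.of_subsingleton⟩
  · refine ⟨-1, ?_⟩
    rintro w ⟨ι, _, D, rfl⟩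
    unfold TreeDecomposition.width
    omega

/-- The tree-width is a lower bound for the width of every tree decomposition. -/
theorem treewidth_le_width {V : Type*} [Finite V] (G : SimpleGraph V) {ι : Type} [Fintype ι]
    (D : G.TreeDecomposition ι) : G.treewidth ≤ D.width := by
  refine csInf_le ⟨-1, ?_⟩ ⟨ι, inferInstance, D, rfl⟩
  rintro w ⟨ι, _, D, rfl⟩
  unfold TreeDecomposition.width
  omega

end SimpleGraph

/-!
The idea is that a graph of bounded degree whose vertices are split into two parts of bounded
tree-width behaves, on a large scale, like a two-dimensional space, while the cube is
three-dimensional. The large-scale dimension is measured by colourings with bounded clusters, where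
a cluster is a connected set of vertices of one colour.

* Three colours are too few for the cube: by the Hex theorem (`exists_large_cluster`), a
  three-colouring of the cube of side `N` has a cluster that connects opposite faces, and so has at
  least `N` vertices. The monotone diagonals triangulate the cube, and the Hex theorem follows from
  Sperner's lemma, which is proved by counting triangles modulo 2.
* A graph of bounded degree and bounded tree-width has a two-colouring with bounded clusters
  (`exists_clustered_coloring`), by recursive splitting along balanced separators. Of the tree-width
  only the consequence `HasCover` is used, that one bag meets all members of a family of pairwise
  intersecting connected sets; it comes from the Helly property of subtrees and survives contractions
  and refinements of the graph.
* Suppose that both parts `A₁`, `A₂` of the cube of side `n` induce subgraphs of small tree-width.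
  Pass to the cube of side `3n - 2`, each point of which has three roundings in the cube of side
  `n`. Let `Yᵢ` consist of the points with some rounding in `Aᵢ`. These sets still have bounded
  covers, because the roundings of adjacent points form a clique (`cubeNear_rounding`), and there
  are no edges between their complements (`exists_rounding_eq`). So `Y₁ ∩ Y₂` is a collar that
  keeps the rest of `Y₁` away from the rest of `Y₂`.
* Two-colour `Y₁` with bounded clusters and give one half the colour `0`. The other half consists of
  bounded pieces, whose part in the collar gets the colour `1` and whose part outside `Y₂` gets the
  colour `2`. It remains to colour the complement of `Y₁` by `1` and `2`. The colour `2` pieces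
  do not touch it, and the colour `1` pieces, being bounded, can be contracted without losing
  bounded degree and bounded covers (`exists_clustered_coloring_forced`). The result is a
  three-colouring whose clusters have bounded size (`exists_clustered_three_coloring`), which is
  impossible for large `n`.
-/

/-! ### Connected sets and covers of intersecting families -/

/-- `y` can be reached from `x` by `r`-steps between elements of `D`. -/
def Linked {V : Type*} (r : V → V → Prop) (D : Set V) : V → V → Prop :=
  Relation.ReflTransGen fun a b => r a b ∧ a ∈ D ∧ b ∈ D

/-- `D` is connected with respect to the relation `r` (the empty set is allowed). -/
def ConnOn {V : Type*} (r : V → V → Prop) (D : Set V) : Prop :=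
  ∀ x ∈ D, ∀ y ∈ D, Linked r D x y

/-- Every family of connected, pairwise intersecting subsets of `Y` is hit by a set of at most
`k` points. This is a consequence of tree-width less than `k` for the graph `r` on `Y`; as opposed to
a tree decomposition, it is easily transferred from one graph to another. -/
def HasCover {V : Type*} (r : V → V → Prop) (Y : Set V) (k : ℕ) : Prop :=
  ∀ F : Set (Set V), (∀ D ∈ F, D ⊆ Y ∧ ConnOn r D) →
    (∀ D ∈ F, ∀ E ∈ F, (D ∩ E).Nonempty) → ∃ X : Finset V, X.card ≤ k ∧ ∀ D ∈ F, ∃ x ∈ X, x ∈ D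

section Linked

variable {V W : Type*} {r : V → V → Prop} {D E : Set V} {x y z : V}

theorem Linked.mono (h : Linked r D x y) (hDE : D ⊆ E) : Linked r E x y :=
  Relation.ReflTransGen.mono (fun _ _ h => ⟨h.1, hDE h.2.1, hDE h.2.2⟩) _ _ h

theorem Linked.symm (hr : ∀ a b, r a b → r b a) (h : Linked r D x y) : Linked r D y x := by
  induction h with
  | refl => exact .refl
  | tail _ hbc ih => exact .head ⟨hr _ _ hbc.1, hbc.2.2, hbc.2.1⟩ ih

theorem Linked.trans (h : Linked r D x y) (h' : Linked r D y z) : Linked r D x z :=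
  Relation.ReflTransGen.trans h h'

theorem Linked.single (h : r x y) (hx : x ∈ D) (hy : y ∈ D) : Linked r D x y :=
  Relation.ReflTransGen.single ⟨h, hx, hy⟩

theorem Linked.mem (h : Linked r D x y) (hx : x ∈ D) : y ∈ D := by
  induction h with
  | refl => exact hx
  | tail _ hbc _ => exact hbc.2.2

/-- A set closed under the steps available inside `D` contains everything linked to it. -/
theorem Linked.mem_of_closed (h : Linked r D x y) {A : Set V} (hx : x ∈ A)
    (hA : ∀ a ∈ A, ∀ b ∈ D, a ∈ D → r a b → b ∈ A) : y ∈ A := by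
  induction h with
  | refl => exact hx
  | tail _ hbc ih => exact hA _ ih _ hbc.2.2 hbc.2.1 hbc.1

theorem ConnOn.subset_of_closed (h : ConnOn r D) {A : Set V} (hDA : (D ∩ A).Nonempty)
    (hA : ∀ a ∈ A, a ∈ D → ∀ b ∈ D, r a b → b ∈ A) : D ⊆ A := by
  obtain ⟨x, hx, hxA⟩ := hDA
  exact fun y hy => (h x hx y hy).mem_of_closed hxA fun a ha b hb haD hab => hA a ha haD b hb hab

/-- The set of points linked to `x` inside `U` is connected. -/
theorem connOn_setOf_linked (hr : ∀ a b, r a b → r b a) (U : Set V) (x : V) :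
    ConnOn r {y | Linked r U x y} := by
  have key : ∀ y, Linked r U x y → Linked r {y | Linked r U x y} x y := by
    intro y h
    induction h with
    | refl => exact .refl
    | tail hab hbc ih => exact .tail ih ⟨hbc.1, hab, .tail hab hbc⟩
  exact fun y hy z hz => ((key y hy).symm hr).trans (key z hz)

theorem ConnOn.image {s : W → W → Prop} {f : V → W} (h : ConnOn r D)
    (hf : ∀ a ∈ D, ∀ b ∈ D, r a b → f a = f b ∨ s (f a) (f b)) : ConnOn s (f '' D) := by
  rintro _ ⟨x, hx, rfl⟩ _ ⟨y, hy, rfl⟩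
  have key := h x hx y hy
  induction key with
  | refl => exact .refl
  | tail _ hbc ih =>
    have ih := ih hbc.2.1
    rcases hf _ hbc.2.1 _ hbc.2.2 hbc.1 with e | e
    · rwa [← e]
    · exact .tail ih ⟨e, ⟨_, hbc.2.1, rfl⟩, ⟨_, hbc.2.2, rfl⟩⟩

theorem SimpleGraph.Connected.connOn {G : SimpleGraph V} (h : (G.induce D).Connected) :
    ConnOn G.Adj D := by
  intro x hx y hy
  have := (SimpleGraph.reachable_iff_reflTransGen _ _).1 (h.preconnected ⟨x, hx⟩ ⟨y, hy⟩)
  exact Relation.ReflTransGen.lift (fun a : D => (a : V))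
    (fun a b hab => ⟨hab, a.2, b.2⟩) _ _ this

end Linked

/-! ### The Helly property of subtrees, and covers from tree decompositions -/

/-- Pairwise intersecting subtrees of a finite tree have a common vertex. The induction removes a
leaf: a subtree containing the leaf is either that leaf or contains its neighbour as well. -/
theorem SimpleGraph.IsTree.helly {ι : Type*} [Finite ι] {T : SimpleGraph ι} (hT : T.IsTree)
    (F : Set (Set ι)) (hF : ∀ D ∈ F, ConnOn T.Adj D)
    (hFF : ∀ D ∈ F, ∀ E ∈ F, (D ∩ E).Nonempty) : ∃ i, ∀ D ∈ F, i ∈ D := by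
  classical
  obtain ⟨n, hn⟩ : ∃ n, Nat.card ι = n := ⟨_, rfl⟩
  induction n generalizing ι with
  | zero =>
    have := hT.connected.nonempty
    exact absurd hn Nat.card_pos.ne'
  | succ n ih =>
    have := Fintype.ofFinite ι
    rcases subsingleton_or_nontrivial ι with hs | hs
    · obtain ⟨i⟩ := hT.connected.nonempty
      refine ⟨i, fun D hD => ?_⟩
      obtain ⟨j, hj, -⟩ := hFF D hD D hD
      rwa [Subsingleton.elim i j]
    obtain ⟨l, hl⟩ := hT.exists_vert_degree_one_of_nontrivial
    obtain ⟨m, hlm, hm⟩ := SimpleGraph.degree_eq_one_iff_existsUnique_adj.1 hl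
    have hml : m ≠ l := hlm.ne'
    by_cases hlF : {l} ∈ F
    · refine ⟨l, fun D hD => ?_⟩
      obtain ⟨j, hj, hj'⟩ := hFF D hD _ hlF
      rwa [← Set.mem_singleton_iff.1 hj']
    -- walks inside `D` can avoid the leaf `l`, ending in `m` instead of `l`
    have walk : ∀ D : Set ι, ∀ x y, Linked T.Adj D x y → x ∈ D → x ≠ l →
        (y ≠ l → Linked T.Adj (D \ {l}) x y) ∧ (y = l → m ∈ D ∧ Linked T.Adj (D \ {l}) x m) := by
      intro D x y h hx hxl
      induction h with
      | refl => exact ⟨fun _ => .refl, fun h => absurd h hxl⟩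
      | @tail b c _ hbc ih =>
        by_cases hb : b = l
        · subst hb
          have hc : c = m := hm c hbc.1
          subst hc
          exact ⟨fun _ => (ih.2 rfl).2, fun h => absurd h hml⟩
        · refine ⟨fun hc => .tail (ih.1 hb) ⟨hbc.1, ⟨hbc.2.1, hb⟩, ⟨hbc.2.2, hc⟩⟩, fun hc => ?_⟩
          subst hc
          have hbm : b = m := hm b hbc.1.symm
          subst hbm
          exact ⟨hbc.2.1, ih.1 hb⟩
    have other : ∀ D ∈ F, ∃ x ∈ D, x ≠ l := by
      intro D hD
      by_contra! h
      obtain ⟨x, hx, -⟩ := hFF D hD D hD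
      refine hlF ?_
      convert hD
      ext y
      exact ⟨fun hy => by rw [Set.mem_singleton_iff.1 hy, ← h x hx]; exact hx, fun hy => h y hy⟩
    have leaf : ∀ D ∈ F, l ∈ D → m ∈ D := by
      intro D hD hlD
      obtain ⟨x, hx, hxl⟩ := other D hD
      exact ((walk D x l (hF D hD x hx l hlD) hx hxl).2 rfl).1
    let S : Set ι := {l}ᶜ
    have hT' : (T.induce S).IsTree :=
      ⟨hT.connected.induce_compl_singleton_of_degree_eq_one hl, hT.isAcyclic.induce _⟩
    have hcard : Nat.card S = n := by
      have : S.ncard + ({l} : Set ι).ncard = Nat.card ι := by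
        rw [add_comm]; exact Set.ncard_add_ncard_compl _
      rw [Set.ncard_singleton, hn] at this
      exact Nat.succ_injective this
    have main := ih hT' ((fun D => ((↑) : S → ι) ⁻¹' D) '' F) ?_ ?_ hcard
    · obtain ⟨i, hi⟩ := main
      exact ⟨i, fun D hD => hi _ ⟨D, hD, rfl⟩⟩
    · rintro _ ⟨D, hD, rfl⟩ ⟨x, hxl⟩ hx ⟨y, hyl⟩ hy
      have h := (walk D x y (hF D hD x hx y hy) hx hxl).1 hyl
      have key : ∀ z, Linked T.Adj (D \ {l}) x z → ∀ hz : z ≠ l,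
          Linked (T.induce S).Adj (((↑) : S → ι) ⁻¹' D) ⟨x, hxl⟩ ⟨z, hz⟩ := by
        intro z h
        induction h with
        | refl => exact fun _ => .refl
        | tail _ hbc ih => exact fun _ => .tail (ih hbc.2.1.2) ⟨hbc.1, hbc.2.1.1, hbc.2.2.1⟩
      exact key y h hyl
    · rintro _ ⟨D, hD, rfl⟩ _ ⟨E, hE, rfl⟩
      obtain ⟨j, hjD, hjE⟩ := hFF D hD E hE
      by_cases hj : j = l
      · subst hj
        exact ⟨⟨m, hml⟩, leaf D hD hjD, leaf E hE hjE⟩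
      · exact ⟨⟨j, hj⟩, hjD, hjE⟩

/-- The easy half of the bramble duality: pairwise intersecting connected sets of vertices are all
hit by one bag of any tree decomposition. -/
theorem SimpleGraph.TreeDecomposition.hasCover {V ι : Type*} [Finite ι] {G : SimpleGraph V}
    (T : G.TreeDecomposition ι) {k : ℕ} (hk : ∀ i, (T.bag i).card ≤ k) (Y : Set V) :
    HasCover G.Adj Y k := by
  intro F hF hFF
  have main := T.isTree.helly ((fun D => {i | ∃ v ∈ T.bag i, v ∈ D}) '' F) ?_ ?_
  · obtain ⟨i, hi⟩ := main
    exact ⟨T.bag i, hk i, fun D hD => hi _ ⟨D, hD, rfl⟩⟩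
  · rintro _ ⟨D, hD, rfl⟩ i ⟨v, hvi, hv⟩ j ⟨w, hwj, hw⟩
    have key := (hF D hD).2 v hv w hw
    have same : ∀ v ∈ D, ∀ i j, v ∈ T.bag i → v ∈ T.bag j →
        Linked T.tree.Adj {i | ∃ v ∈ T.bag i, v ∈ D} i j := fun v hv i j hi hj =>
      ((T.connected v).connOn i hi j hj).mono fun _ h => ⟨v, h, hv⟩
    induction key generalizing j with
    | refl => exact same v hv i j hvi hwj
    | tail _ hbc ih =>
      obtain ⟨l, hbl, hcl⟩ := T.edge_mem _ _ hbc.1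
      exact (ih l hbl hbc.2.1).trans (same _ hbc.2.2 l j hcl hwj)
  · rintro _ ⟨D, hD, rfl⟩ _ ⟨E, hE, rfl⟩
    obtain ⟨v, hvD, hvE⟩ := hFF D hD E hE
    obtain ⟨i, hi⟩ := T.vertex_mem v
    exact ⟨i, ⟨v, hi, hvD⟩, ⟨v, hi, hvE⟩⟩

theorem SimpleGraph.hasCover_of_treewidth_lt {V : Type*} [Finite V] (G : SimpleGraph V) {t : ℕ}
    (h : G.treewidth < t) (Y : Set V) : HasCover G.Adj Y t := by
  obtain ⟨ι, _, T, hT⟩ := G.exists_width_eq_treewidth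
  refine T.hasCover (fun i => ?_) Y
  have h1 : (T.bag i).card ≤ Finset.univ.sup fun i => (T.bag i).card :=
    Finset.le_sup (f := fun i => (T.bag i).card) (Finset.mem_univ i)
  rw [← hT] at h
  unfold SimpleGraph.TreeDecomposition.width at h
  omega

/-- Covers are pulled back along maps with small fibres that send edges to edges or points. -/
theorem HasCover.comap {V W : Type*} [Fintype V] [DecidableEq W] {r : V → V → Prop}
    {s : W → W → Prop} {k m : ℕ} {Y : Set V} {Z : Set W} (hZ : HasCover s Z k) (f : V → W)
    (hfZ : ∀ a ∈ Y, f a ∈ Z)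
    (hf : ∀ a ∈ Y, ∀ b ∈ Y, r a b → f a = f b ∨ s (f a) (f b))
    (hm : ∀ w, (Finset.univ.filter fun v => f v = w).card ≤ m) : HasCover r Y (k * m) := by
  classical
  intro F hF hFF
  have main := hZ ((fun D => f '' D) '' F) ?_ ?_
  · obtain ⟨X, hXk, hX⟩ := main
    refine ⟨X.biUnion fun w => Finset.univ.filter fun v => f v = w, ?_, fun D hD => ?_⟩
    · exact (Finset.card_biUnion_le_card_mul _ _ m fun w _ => hm w).trans
        (Nat.mul_le_mul_right m hXk)
    · obtain ⟨_, hx, v, hv, rfl⟩ := hX _ ⟨D, hD, rfl⟩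
      exact ⟨v, by simpa using hx, hv⟩
  · rintro _ ⟨D, hD, rfl⟩
    obtain ⟨hDY, hDc⟩ := hF D hD
    refine ⟨?_, hDc.image fun a ha b hb => hf a (hDY ha) b (hDY hb)⟩
    rintro _ ⟨v, hv, rfl⟩
    exact hfZ v (hDY hv)
  · rintro _ ⟨D, hD, rfl⟩ _ ⟨E, hE, rfl⟩
    obtain ⟨v, hvD, hvE⟩ := hFF D hD E hE
    exact ⟨f v, ⟨v, hvD, rfl⟩, ⟨v, hvE, rfl⟩⟩

/-! ### Clustered two-colourings -/

/-- A bound on the part that contains a given set of `s` points in the construction of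
`exists_rootedColouring`, where sets of at most `s₀` points are parts by themselves. -/
def partBound (s₀ : ℕ) : ℕ → ℕ
  | 0 => s₀ + 1
  | s + 1 => s₀ + 1 + (s + 1) * partBound s₀ s

/-- The bound on the clusters of a two-colouring of a graph of maximum degree at most `Δ` whose
connected intersecting families have covers of size `k`. -/
def clusterBound (k Δ : ℕ) : ℕ :=
  partBound (2 * k + 1) ((2 * k + 1) + (2 * k + 1) * Δ)

theorem lt_partBound (s₀ s : ℕ) : s₀ < partBound s₀ s := by
  cases s <;> simp only [partBound] <;> omega

theorem partBound_mono (s₀ : ℕ) : Monotone (partBound s₀) := by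
  refine monotone_nat_of_le_succ fun s => ?_
  simp only [partBound]
  nlinarith [Nat.zero_le (partBound s₀ s)]

/-- Every connected subset of `Y` of constant colour has at most `C` points. -/
def Clustered {V α : Type*} (r : V → V → Prop) (Y : Set V) (col : V → α) (C : ℕ) : Prop :=
  ∀ D : Finset V, (D : Set V) ⊆ Y → ConnOn r D → (∀ x ∈ D, ∀ y ∈ D, col x = col y) → D.card ≤ C

/-- A clustered two-colouring of `U` in which the set `P ⊇ S` is a union of clusters of colour
`true`. -/
structure IsRootedColouring {V : Type*} (r : V → V → Prop) (C : ℕ) (U S P : Finset V)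
    (col : V → Bool) : Prop where
  root_subset : S ⊆ P
  subset : P ⊆ U
  color_true : ∀ v ∈ P, col v = true
  closed : ∀ v ∈ P, ∀ w ∈ U, r v w → col w = true → w ∈ P
  clustered : Clustered r (U : Set V) col C

section Colouring

variable {V : Type*} [DecidableEq V] {r : V → V → Prop} {k Δ C : ℕ}

/-- A cover of all connected sets that contain more than half of `S` is a balanced separator. -/
theorem HasCover.exists_separator {Y : Set V} (hY : HasCover r Y k) (S : Finset V) :
    ∃ X : Finset V, X.card ≤ k ∧ ∀ D : Finset V, (D : Set V) ⊆ Y → ConnOn r D → Disjoint D X →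
      2 * (D ∩ S).card ≤ S.card := by
  have main := hY {E | ∃ D : Finset V, E = D ∧ (D : Set V) ⊆ Y ∧ ConnOn r D ∧
    S.card < 2 * (D ∩ S).card} ?_ ?_
  · obtain ⟨X, hXk, hX⟩ := main
    refine ⟨X, hXk, fun D hDY hDc hDX => ?_⟩
    by_contra! h
    obtain ⟨x, hx, hxD⟩ := hX D ⟨D, rfl, hDY, hDc, h⟩
    exact Finset.disjoint_left.1 hDX hxD hx
  · rintro _ ⟨D, rfl, h1, h2, -⟩
    exact ⟨h1, h2⟩
  · rintro _ ⟨D, rfl, -, -, hD⟩ _ ⟨E, rfl, -, -, hE⟩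
    have h1 := Finset.card_union_add_card_inter (D ∩ S) (E ∩ S)
    have h2 : ((D ∩ S) ∪ (E ∩ S)).card ≤ S.card :=
      Finset.card_le_card (Finset.union_subset Finset.inter_subset_right Finset.inter_subset_right)
    have h3 : 0 < ((D ∩ S) ∩ (E ∩ S)).card := by omega
    obtain ⟨x, hx⟩ := Finset.card_pos.1 h3
    simp only [Finset.mem_inter] at hx
    exact ⟨x, hx.1.1, hx.2.1⟩

variable [Fintype V]

/-- Gluing: if `X` separates `U` into components, colourings of the components together with `X`,
all with `X` in the root part, combine into a colouring of `U`. -/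
theorem exists_rootedColouring_glue (hr : ∀ a b, r a b → r b a) {s₀ f : ℕ} {U S X : Finset V}
    (hSU : S ⊆ U) (hXs : X.card ≤ s₀)
    (hC : s₀ + S.card * f ≤ C)
    (h : ∀ K : Finset V, K ⊆ U \ X → ConnOn r K →
      ∃ P col, IsRootedColouring r C (K ∪ X ∩ U) (S ∩ K ∪ X ∩ U) P col ∧ P.card ≤ f ∧
        (S ∩ K = ∅ → P = X ∩ U)) :
    ∃ P col, IsRootedColouring r C U S P col ∧ P.card ≤ s₀ + S.card * f := by
  classical
  choose! P col hP using h
  -- the component of `v`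
  let K : V → Finset V := fun v => Finset.univ.filter fun w => Linked r (↑(U \ X) : Set V) v w
  have hKmem : ∀ v w, w ∈ K v ↔ Linked r (↑(U \ X) : Set V) v w := by simp [K]
  have hself : ∀ v, v ∈ K v := fun v => (hKmem v v).2 .refl
  have hKsub : ∀ v ∈ U \ X, K v ⊆ U \ X := fun v hv w hw => by
    exact_mod_cast ((hKmem v w).1 hw).mem (by exact_mod_cast hv)
  have hKconn : ∀ v, ConnOn r (K v : Set V) := fun v => by
    have := connOn_setOf_linked hr (↑(U \ X) : Set V) v
    convert this using 1
    ext w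
    simp [K]
  have hKeq : ∀ v w, w ∈ K v → K v = K w := by
    intro v w hw
    ext x
    rw [hKmem, hKmem]
    rw [hKmem] at hw
    exact ⟨fun hx => (hw.symm hr).trans hx, fun hx => hw.trans hx⟩
  have hKadj : ∀ v ∈ U \ X, ∀ w ∈ U \ X, r v w → K v = K w := fun v hv w hw hvw =>
    hKeq v w ((hKmem v w).2 (.single hvw (by exact_mod_cast hv) (by exact_mod_cast hw)))
  have hroot : ∀ v ∈ U \ X, IsRootedColouring r C (K v ∪ X ∩ U) (S ∩ K v ∪ X ∩ U) (P (K v))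
      (col (K v)) := fun v hv => (hP _ (hKsub v hv) (hKconn v)).1
  let c : V → Bool := fun v => if v ∈ X then true else col (K v) v
  let R : Finset V := U.filter fun v => v ∈ X ∨ v ∈ P (K v)
  have hmemR : ∀ v, v ∈ R ↔ v ∈ U ∧ (v ∈ X ∨ v ∈ P (K v)) := by simp [R]
  have hcl : ∀ v ∈ R, ∀ w ∈ U, r v w → c w = true → w ∈ R := by
    intro v hv w hw hvw hc
    rw [hmemR] at hv ⊢
    refine ⟨hw, ?_⟩
    by_cases hwX : w ∈ X
    · exact Or.inl hwX
    have hwU : w ∈ U \ X := Finset.mem_sdiff.2 ⟨hw, hwX⟩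
    have hc' : col (K w) w = true := by simpa [c, hwX] using hc
    refine Or.inr ((hroot w hwU).closed v ?_ w ?_ hvw hc')
    · by_cases hvX : v ∈ X
      · exact (hroot w hwU).root_subset (by simp [hvX, hv.1])
      · rw [← hKadj v (Finset.mem_sdiff.2 ⟨hv.1, hvX⟩) w hwU hvw]
        exact hv.2.resolve_left hvX
    · exact Finset.mem_union_left _ (hself w)
  have hRcard : R.card ≤ s₀ + S.card * f := by
    have hsub : R ⊆ X ∪ (S \ X).biUnion fun s => P (K s) := by
      intro v hv
      rw [hmemR] at hv
      by_cases hvX : v ∈ X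
      · exact Finset.mem_union_left _ hvX
      have hvU : v ∈ U \ X := Finset.mem_sdiff.2 ⟨hv.1, hvX⟩
      have hvP := hv.2.resolve_left hvX
      have hne : S ∩ K v ≠ ∅ := by
        intro he
        rw [(hP _ (hKsub v hvU) (hKconn v)).2.2 he] at hvP
        exact hvX (Finset.mem_inter.1 hvP).1
      obtain ⟨s, hs⟩ := Finset.nonempty_iff_ne_empty.2 hne
      rw [Finset.mem_inter] at hs
      refine Finset.mem_union_right _ (Finset.mem_biUnion.2 ⟨s, ?_, ?_⟩)
      · exact Finset.mem_sdiff.2 ⟨hs.1, (Finset.mem_sdiff.1 (hKsub v hvU hs.2)).2⟩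
      · rwa [← hKeq v s hs.2]
    refine (Finset.card_le_card hsub).trans ((Finset.card_union_le _ _).trans ?_)
    refine Nat.add_le_add hXs ((Finset.card_biUnion_le_card_mul _ _ f ?_).trans ?_)
    · intro s hs
      rw [Finset.mem_sdiff] at hs
      exact (hP _ (hKsub s (Finset.mem_sdiff.2 ⟨hSU hs.1, hs.2⟩)) (hKconn s)).2.1
    · exact Nat.mul_le_mul_right f (Finset.card_le_card Finset.sdiff_subset)
  have hct : ∀ v ∈ R, c v = true := by
    intro v hv
    rw [hmemR] at hv
    by_cases hvX : v ∈ X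
    · simp [c, hvX]
    · simpa [c, hvX] using (hroot v (Finset.mem_sdiff.2 ⟨hv.1, hvX⟩)).color_true v
        (hv.2.resolve_left hvX)
  refine ⟨R, c, ⟨?_, Finset.filter_subset _ _, hct, hcl, ?_⟩, hRcard⟩
  · intro s hs
    rw [hmemR]
    refine ⟨hSU hs, ?_⟩
    by_cases hsX : s ∈ X
    · exact Or.inl hsX
    · refine Or.inr ((hroot s (Finset.mem_sdiff.2 ⟨hSU hs, hsX⟩)).root_subset ?_)
      exact Finset.mem_union_left _ (Finset.mem_inter.2 ⟨hs, hself s⟩)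
  · intro D hDU hDc hmono
    by_cases hDR : ∃ x ∈ D, x ∈ R
    · obtain ⟨x, hx, hxR⟩ := hDR
      refine (Finset.card_le_card ?_).trans (hRcard.trans hC)
      have : (D : Set V) ⊆ (R : Set V) := by
        refine hDc.subset_of_closed ⟨x, hx, hxR⟩ fun a ha _ b hb hab => ?_
        exact hcl a ha b (hDU hb) hab ((hmono b hb x hx).trans (hct x hxR))
      exact_mod_cast this
    · push Not at hDR
      have hDX : ∀ x ∈ D, x ∈ U \ X := fun x hx => Finset.mem_sdiff.2
        ⟨hDU hx, fun hxX => hDR x hx ((hmemR x).2 ⟨hDU hx, Or.inl hxX⟩)⟩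
      rcases D.eq_empty_or_nonempty with rfl | ⟨x, hx⟩
      · simp
      have hDK : D ⊆ K x := by
        intro y hy
        exact (hKmem x y).2 ((hDc x hx y hy).mono fun z hz => by exact_mod_cast hDX z hz)
      refine (hroot x (hDX x hx)).clustered D ?_ hDc ?_
      · intro y hy
        exact_mod_cast Finset.mem_union_left _ (hDK hy)
      · intro y hy z hz
        have h1 := hmono y hy z hz
        have e : ∀ y ∈ D, c y = col (K x) y := fun y hy => by
          simp [c, (Finset.mem_sdiff.1 (hDX y hy)).2, hKeq x y (hDK hy)]
        rwa [e y hy, e z hz] at h1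

variable [DecidableRel r]

/-- The points that are related to some point of `S`. -/
def nbrs (r : V → V → Prop) [DecidableRel r] (S : Finset V) : Finset V :=
  S.biUnion fun v => Finset.univ.filter (r v)

theorem mem_nbrs {S : Finset V} {w : V} : w ∈ nbrs r S ↔ ∃ v ∈ S, r v w := by
  simp [nbrs]

theorem card_nbrs_le (hΔ : ∀ v, (Finset.univ.filter (r v)).card ≤ Δ) (S : Finset V) :
    (nbrs r S).card ≤ S.card * Δ :=
  Finset.card_biUnion_le_card_mul _ _ Δ fun v _ => hΔ v

/-- A small root set is made a part by itself: its neighbours form the root set of a colouring of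
the rest, whose colours are then exchanged. -/
theorem exists_rootedColouring_of_small {s₀ : ℕ} {U S : Finset V} (hSU : S ⊆ U)
    (hS : S.card ≤ s₀) (hC : s₀ ≤ C)
    (h : ∃ P col, IsRootedColouring r C (U \ S) (nbrs r S ∩ (U \ S)) P col) :
    ∃ col, IsRootedColouring r C U S S col := by
  obtain ⟨P, col, hP⟩ := h
  have hcl : ∀ v ∈ S, ∀ w ∈ U, r v w → (if w ∈ S then true else !col w) = true → w ∈ S := by
    intro v hv w hw hvw hc
    by_contra hwS
    have hwP : w ∈ P := hP.root_subset (by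
      simp only [Finset.mem_inter, Finset.mem_sdiff, mem_nbrs]
      exact ⟨⟨v, hv, hvw⟩, hw, hwS⟩)
    simp [hwS, hP.color_true w hwP] at hc
  refine ⟨fun v => if v ∈ S then true else !col v, subset_rfl, hSU, ?_, hcl, ?_⟩
  · intro v hv
    simp [hv]
  · intro D hDU hDc hmono
    by_cases hDS : ∃ x ∈ D, x ∈ S
    · obtain ⟨x, hx, hxS⟩ := hDS
      refine (Finset.card_le_card ?_).trans (hS.trans hC)
      have : (D : Set V) ⊆ (S : Set V) := by
        refine hDc.subset_of_closed ⟨x, hx, hxS⟩ fun a ha _ b hb hab => ?_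
        refine hcl a ha b (hDU hb) hab ?_
        have := hmono b hb x hx
        simpa [hxS] using this
      exact_mod_cast this
    · push Not at hDS
      refine hP.clustered D ?_ hDc ?_
      · intro x hx
        simpa using ⟨hDU hx, hDS x hx⟩
      · intro x hx y hy
        simpa [hDS x hx, hDS y hy] using hmono x hx y hy

/-- The induction behind `exists_clustered_coloring`: small root sets are parts by themselves,
and a large root set is split by a balanced separator. -/
theorem exists_rootedColouring (hr : ∀ a b, r a b → r b a)
    (hΔ : ∀ v, (Finset.univ.filter (r v)).card ≤ Δ) {Y : Finset V} (hY : HasCover r (Y : Set V) k) :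
    ∀ U ⊆ Y, ∀ S ⊆ U, S.card ≤ (2 * k + 1) + (2 * k + 1) * Δ →
      ∃ P col, IsRootedColouring r (clusterBound k Δ) U S P col ∧
        P.card ≤ partBound (2 * k + 1) S.card ∧ (S.card ≤ 2 * k + 1 → P = S) := by
  intro U
  induction hU : U.card using Nat.strong_induction_on generalizing U with
  | _ u ihU =>
  subst hU
  intro hUY
  have hs₀ : 2 * k + 1 ≤ clusterBound k Δ := (lt_partBound _ _).le
  have small : ∀ S ⊆ U, S.Nonempty → S.card ≤ 2 * k + 1 →
      ∃ col, IsRootedColouring r (clusterBound k Δ) U S S col := by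
    intro S hSU hSne hS
    refine exists_rootedColouring_of_small hSU hS hs₀ ?_
    have main := ihU (U \ S).card
      (Finset.card_lt_card (Finset.sdiff_ssubset hSU hSne)) (U \ S) rfl
      (Finset.sdiff_subset.trans hUY) (nbrs r S ∩ (U \ S)) Finset.inter_subset_right ?_
    · obtain ⟨P, col, h, -⟩ := main
      exact ⟨P, col, h⟩
    · have h1 := card_nbrs_le hΔ S
      have h2 : (nbrs r S ∩ (U \ S)).card ≤ (nbrs r S).card :=
        Finset.card_le_card Finset.inter_subset_left
      have h3 := Nat.mul_le_mul_right Δ hS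
      omega
  have small' : ∀ S ⊆ U, S.card ≤ 2 * k + 1 →
      ∃ col, IsRootedColouring r (clusterBound k Δ) U S S col := by
    intro S hSU hS
    rcases S.eq_empty_or_nonempty with rfl | hne
    · rcases U.eq_empty_or_nonempty with rfl | ⟨v, hv⟩
      · refine ⟨fun _ => true, subset_rfl, subset_rfl, by simp, by simp, ?_⟩
        intro D hD _ _
        have : D = ∅ := by simpa using hD
        simp [this]
      · obtain ⟨col, h⟩ := small {v} (by simpa using hv) (by simp) (by simp)
        exact ⟨col, subset_rfl, by simp, by simp, by simp, h.clustered⟩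
    · exact small S hSU hne hS
  intro S
  induction hs : S.card using Nat.strong_induction_on generalizing S with
  | _ s ihS =>
  subst hs
  intro hSU hSM
  by_cases hS : S.card ≤ 2 * k + 1
  · obtain ⟨col, h⟩ := small' S hSU hS
    exact ⟨S, col, h, hS.trans (lt_partBound _ _).le, fun _ => rfl⟩
  obtain ⟨X, hXk, hX⟩ := hY.exists_separator S
  obtain ⟨s', hs'⟩ : ∃ s', S.card = s' + 1 := ⟨S.card - 1, by omega⟩
  have hbound : partBound (2 * k + 1) S.card
      = 2 * k + 1 + 1 + S.card * partBound (2 * k + 1) s' := by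
    rw [hs']; rfl
  have hfC : partBound (2 * k + 1) S.card ≤ clusterBound k Δ := partBound_mono _ hSM
  have main := exists_rootedColouring_glue (r := r) hr (s₀ := 2 * k + 1 + 1)
    (f := partBound (2 * k + 1) s') (C := clusterBound k Δ) (X := X) hSU (by omega)
    (by rw [← hbound]; exact hfC) ?_
  · obtain ⟨P, col, h, hP⟩ := main
    exact ⟨P, col, h, by rw [hbound]; exact hP, fun h => absurd h hS⟩
  intro K hK hKc
  have hKU : K ⊆ U := hK.trans Finset.sdiff_subset
  have hKX : Disjoint K X := Finset.disjoint_of_subset_left hK Finset.sdiff_disjoint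
  have hhalf := hX K (by exact_mod_cast hKU.trans hUY) hKc hKX
  have hXU : (X ∩ U).card ≤ k := (Finset.card_le_card Finset.inter_subset_left).trans hXk
  have hcard : (S ∩ K ∪ X ∩ U).card ≤ s' := by
    have := Finset.card_union_le (S ∩ K) (X ∩ U)
    rw [Finset.inter_comm K S] at hhalf
    omega
  have hsub : S ∩ K ∪ X ∩ U ⊆ K ∪ X ∩ U :=
    Finset.union_subset_union Finset.inter_subset_right subset_rfl
  have hUsub : K ∪ X ∩ U ⊆ U := Finset.union_subset hKU Finset.inter_subset_right
  have key : ∃ P col, IsRootedColouring r (clusterBound k Δ) (K ∪ X ∩ U) (S ∩ K ∪ X ∩ U) P col ∧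
        P.card ≤ partBound (2 * k + 1) (S ∩ K ∪ X ∩ U).card ∧
        ((S ∩ K ∪ X ∩ U).card ≤ 2 * k + 1 → P = S ∩ K ∪ X ∩ U) := by
    rcases hUsub.eq_or_ssubset with he | hlt
    · rw [he] at hsub ⊢
      exact ihS _ (by omega) _ rfl hsub (by omega)
    · exact ihU _ (Finset.card_lt_card hlt) _ rfl (hUsub.trans hUY) _ hsub (by omega)
  obtain ⟨P, col, h, h1, h2⟩ := key
  refine ⟨P, col, h, h1.trans (partBound_mono _ hcard), fun he => ?_⟩
  rw [he, Finset.empty_union] at h2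
  exact h2 (by omega)

/-- A graph of bounded degree and bounded tree-width has a two-colouring with bounded clusters. -/
theorem exists_clustered_coloring (hr : ∀ a b, r a b → r b a)
    (hΔ : ∀ v, (Finset.univ.filter (r v)).card ≤ Δ) {Y : Finset V}
    (hY : HasCover r (Y : Set V) k) :
    ∃ col : V → Bool, Clustered r (Y : Set V) col (clusterBound k Δ) := by
  obtain ⟨P, col, h, -⟩ := exists_rootedColouring hr hΔ hY Y subset_rfl ∅ (by simp) (by simp)
  exact ⟨col, h.clustered⟩

end Colouring

/-! ### Clustered three-colourings from two sets with covers -/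

section Forced

variable {V : Type*} {r : V → V → Prop}

/-- Two points are joined if they are related or if both are related to the same component
of `K`. -/
def JoinedVia (r : V → V → Prop) (K : Set V) (x y : V) : Prop :=
  r x y ∨ ∃ a ∈ K, ∃ b, r x a ∧ Linked r K a b ∧ r b y

/-- The set `D` together with the components of `K` to which it is related. -/
def hullVia (r : V → V → Prop) (K D : Set V) : Set V :=
  D ∪ {y | ∃ x ∈ D, ∃ a ∈ K, r x a ∧ Linked r K a y}

theorem JoinedVia.symm (hr : ∀ a b, r a b → r b a) {K : Set V} {x y : V}
    (h : JoinedVia r K x y) : JoinedVia r K y x := by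
  rcases h with h | ⟨a, ha, b, hxa, hab, hby⟩
  · exact Or.inl (hr _ _ h)
  · exact Or.inr ⟨b, hab.mem ha, a, hr _ _ hby, hab.symm hr, hr _ _ hxa⟩

/-- What is connected through components of `K` becomes connected after adding these. -/
theorem connOn_hullVia (hr : ∀ a b, r a b → r b a) {K D : Set V} (h : ConnOn (JoinedVia r K) D) :
    ConnOn r (hullVia r K D) := by
  have hsub : D ⊆ hullVia r K D := Set.subset_union_left
  -- every component of `K` related to `x ∈ D` is reached from `x`
  have comp : ∀ x ∈ D, ∀ a ∈ K, r x a → ∀ y, Linked r K a y →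
      Linked r (hullVia r K D) x y := by
    intro x hx a ha hxa y hay
    have hmem : ∀ z, Linked r K a z → z ∈ hullVia r K D := fun z hz =>
      Or.inr ⟨x, hx, a, ha, hxa, hz⟩
    induction hay with
    | refl => exact .single hxa (hsub hx) (hmem a .refl)
    | tail hab hbc ih => exact .tail ih ⟨hbc.1, hmem _ hab, hmem _ (.tail hab hbc)⟩
  have inside : ∀ x ∈ D, ∀ y ∈ D, Linked r (hullVia r K D) x y := by
    intro x hx y hy
    have key := h x hx y hy
    induction key with
    | refl => exact .refl
    | tail _ hbc ih =>
      obtain ⟨hbc, hb, hc⟩ := hbc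
      refine (ih hb).trans ?_
      rcases hbc with h | ⟨a, ha, b', hba, hab, hbc⟩
      · exact .single h (hsub hb) (hsub hc)
      · exact (comp _ hb a ha hba b' hab).tail
          ⟨hbc, Or.inr ⟨_, hb, a, ha, hba, hab⟩, hsub hc⟩
  have reach : ∀ y ∈ hullVia r K D, ∃ x ∈ D, Linked r (hullVia r K D) x y := by
    rintro y (hy | ⟨x, hx, a, ha, hxa, hay⟩)
    · exact ⟨y, hy, .refl⟩
    · exact ⟨x, hx, comp x hx a ha hxa y hay⟩
  intro y hy z hz
  obtain ⟨x, hx, hxy⟩ := reach y hy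
  obtain ⟨x', hx', hxz⟩ := reach z hz
  exact ((hxy.symm hr).trans (inside x hx x' hx')).trans hxz

/-- The points of `R` in a connected set `D ⊆ R ∪ K` are connected through components of `K`,
and if there are any, the rest of `D` lies in components of `K` to which they are related. -/
theorem ConnOn.joinedVia {R K D : Set V} (hRK : Disjoint R K) (hD : D ⊆ R ∪ K) (h : ConnOn r D) :
    ConnOn (JoinedVia r K) (D ∩ R) ∧ ((D ∩ R).Nonempty → D ⊆ hullVia r K (D ∩ R)) := by
  have key : ∀ x ∈ D ∩ R, ∀ y, Linked r D x y → (y ∈ R ∧ Linked (JoinedVia r K) (D ∩ R) x y) ∨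
      ∃ x' ∈ D ∩ R, Linked (JoinedVia r K) (D ∩ R) x x' ∧
        ∃ a ∈ K, r x' a ∧ Linked r K a y := by
    intro x hx y hxy
    induction hxy with
    | refl => exact Or.inl ⟨hx.2, .refl⟩
    | tail _ hbc ih =>
      obtain ⟨hbc, hb, hc⟩ := hbc
      rcases ih with ⟨hbR, hxb⟩ | ⟨x', hx', hxx', a, ha, hxa, hab⟩
      · rcases hD hc with hcR | hcK
        · exact Or.inl ⟨hcR, hxb.tail ⟨Or.inl hbc, ⟨hb, hbR⟩, ⟨hc, hcR⟩⟩⟩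
        · exact Or.inr ⟨_, ⟨hb, hbR⟩, hxb, _, hcK, hbc, .refl⟩
      · rcases hD hc with hcR | hcK
        · exact Or.inl ⟨hcR, hxx'.tail ⟨Or.inr ⟨a, ha, _, hxa, hab, hbc⟩, hx', ⟨hc, hcR⟩⟩⟩
        · exact Or.inr ⟨x', hx', hxx', a, ha, hxa, hab.tail ⟨hbc, hab.mem ha, hcK⟩⟩
  refine ⟨?_, ?_⟩
  · intro x hx y hy
    rcases key x hx y (h x hx.1 y hy.1) with ⟨_, hl⟩ | ⟨_, _, _, a, ha, _, hay⟩
    · exact hl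
    · exact absurd (hay.mem ha) (Set.disjoint_left.1 hRK hy.2)
  · rintro ⟨x, hx⟩ y hy
    rcases key x hx y (h x hx.1 y hy) with ⟨hyR, hl⟩ | ⟨x', hx', _, a, ha, hxa, hay⟩
    · exact Or.inl ⟨hy, hyR⟩
    · exact Or.inr ⟨x', hx', a, ha, hxa, hay⟩

variable [Fintype V] [DecidableEq V] {k Δ m : ℕ}

/-- The components of `K` that are related to points of `A` have few points in total. -/
theorem exists_finset_hullVia [DecidableRel r]
    (hΔ : ∀ v, (Finset.univ.filter (r v)).card ≤ Δ) {K : Finset V}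
    (hK : ∀ D : Finset V, D ⊆ K → ConnOn r (D : Set V) → D.card ≤ m)
    (hr : ∀ a b, r a b → r b a) (A : Finset V) :
    ∃ B : Finset V, (∀ y, y ∈ B ↔ ∃ x ∈ A, ∃ a ∈ K, r x a ∧ Linked r K a y) ∧
      B.card ≤ A.card * Δ * m := by
  classical
  refine ⟨(nbrs r A ∩ K).biUnion fun a => Finset.univ.filter fun y => Linked r K a y, ?_, ?_⟩
  · intro y
    simp only [Finset.mem_biUnion, Finset.mem_inter, mem_nbrs, Finset.mem_filter,
      Finset.mem_univ, true_and]
    exact ⟨fun ⟨a, ⟨⟨x, hx, hxa⟩, ha⟩, hay⟩ => ⟨x, hx, a, ha, hxa, hay⟩,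
      fun ⟨x, hx, a, ha, hxa, hay⟩ => ⟨a, ⟨⟨x, hx, hxa⟩, ha⟩, hay⟩⟩
  · refine (Finset.card_biUnion_le_card_mul _ _ m ?_).trans (Nat.mul_le_mul_right m
      ((Finset.card_le_card Finset.inter_subset_left).trans (card_nbrs_le hΔ A)))
    intro a ha
    have haK := (Finset.mem_inter.1 ha).2
    refine hK _ (fun y hy => ?_) ?_
    · exact_mod_cast ((Finset.mem_filter.1 hy).2).mem (by exact_mod_cast haK)
    · convert connOn_setOf_linked hr (K : Set V) a using 1
      ext; simp

/-- The bound on the clusters of a two-colouring with a forced set of clusters of size `m`. -/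
def forcedBound (k Δ m : ℕ) : ℕ :=
  clusterBound (k + k * m * Δ) (Δ + Δ * m * Δ)

/-- A two-colouring of `R` with bounded clusters, even after a set `K` with bounded components is
added to the colour `true`. It is a clustered colouring of the graph in which the components of
`K` are contracted to edges between points of `R`. -/
theorem exists_clustered_coloring_forced [DecidableRel r] (hr : ∀ a b, r a b → r b a)
    (hΔ : ∀ v, (Finset.univ.filter (r v)).card ≤ Δ) {R K : Finset V} (hRK : Disjoint R K)
    (hcov : HasCover r (↑(R ∪ K) : Set V) k)
    (hK : ∀ D : Finset V, D ⊆ K → ConnOn r (D : Set V) → D.card ≤ m) :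
    ∃ col : V → Bool,
      (∀ D : Finset V, D ⊆ R → ConnOn r (D : Set V) → (∀ x ∈ D, col x = false) →
        D.card ≤ forcedBound k Δ m) ∧
      (∀ D : Finset V, D ⊆ R ∪ K → ConnOn r (D : Set V) → (∀ x ∈ D, x ∈ R → col x = true) →
        D.card ≤ m + forcedBound k Δ m + forcedBound k Δ m * Δ * m) := by
  classical
  have hdisj : Disjoint (R : Set V) (K : Set V) := by exact_mod_cast hRK
  have hull := exists_finset_hullVia hΔ hK hr
  have hdeg : ∀ v, (Finset.univ.filter (JoinedVia r (K : Set V) v)).card ≤ Δ + Δ * m * Δ := by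
    intro v
    obtain ⟨B, hB, hBc⟩ := hull {v}
    have hsub : Finset.univ.filter (JoinedVia r (K : Set V) v) ⊆
        Finset.univ.filter (r v) ∪ nbrs r B := by
      intro y hy
      rcases (Finset.mem_filter.1 hy).2 with h | ⟨a, ha, b, hva, hab, hby⟩
      · exact Finset.mem_union_left _ (by simpa using h)
      · refine Finset.mem_union_right _ (mem_nbrs.2 ⟨b, (hB b).2 ?_, hby⟩)
        exact ⟨v, by simp, a, ha, hva, hab⟩
    refine (Finset.card_le_card hsub).trans ((Finset.card_union_le _ _).trans ?_)
    refine Nat.add_le_add (hΔ v) ((card_nbrs_le hΔ B).trans (Nat.mul_le_mul_right Δ ?_))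
    simpa using hBc
  have hcov' : HasCover (JoinedVia r (K : Set V)) (R : Set V) (k + k * m * Δ) := by
    intro F hF hFF
    have main := hcov ((fun D => hullVia r (K : Set V) D) '' F) ?_ ?_
    · obtain ⟨X, hXk, hX⟩ := main
      -- a component of `K` that meets `X` is replaced by the points related to it
      let B : Finset V := (X ∩ K).biUnion fun a => Finset.univ.filter fun y => Linked r K a y
      have hBc : B.card ≤ k * m := by
        refine (Finset.card_biUnion_le_card_mul _ _ m ?_).trans (Nat.mul_le_mul_right m
          ((Finset.card_le_card Finset.inter_subset_left).trans hXk))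
        intro a ha
        refine hK _ (fun y hy => ?_) ?_
        · exact_mod_cast ((Finset.mem_filter.1 hy).2).mem
            (by exact_mod_cast (Finset.mem_inter.1 ha).2)
        · convert connOn_setOf_linked hr (K : Set V) a using 1
          ext; simp
      refine ⟨X ∪ nbrs r B, ?_, fun D hD => ?_⟩
      · exact (Finset.card_union_le _ _).trans (Nat.add_le_add hXk
          ((card_nbrs_le hΔ B).trans (Nat.mul_le_mul_right Δ hBc)))
      · obtain ⟨x, hxX, hx | ⟨x', hx', a, ha, hxa, hax⟩⟩ := hX _ ⟨D, hD, rfl⟩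
        · exact ⟨x, Finset.mem_union_left _ hxX, hx⟩
        · refine ⟨x', Finset.mem_union_right _ (mem_nbrs.2 ⟨a, ?_, hr _ _ hxa⟩), hx'⟩
          refine Finset.mem_biUnion.2 ⟨x, Finset.mem_inter.2 ⟨hxX, ?_⟩, ?_⟩
          · exact_mod_cast hax.mem ha
          · simpa using hax.symm hr
    · rintro _ ⟨D, hD, rfl⟩
      refine ⟨?_, connOn_hullVia hr (hF D hD).2⟩
      rintro y (hy | ⟨x, hx, a, ha, -, hay⟩)
      · exact_mod_cast Finset.mem_union_left _ (by exact_mod_cast (hF D hD).1 hy)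
      · exact_mod_cast Finset.mem_union_right _ (by exact_mod_cast hay.mem ha)
    · rintro _ ⟨D, hD, rfl⟩ _ ⟨E, hE, rfl⟩
      obtain ⟨x, hxD, hxE⟩ := hFF D hD E hE
      exact ⟨x, Or.inl hxD, Or.inl hxE⟩
  obtain ⟨col, hcol⟩ := exists_clustered_coloring (fun a b => JoinedVia.symm hr) hdeg hcov'
  refine ⟨col, fun D hD hDc hmono => ?_, fun D hD hDc hmono => ?_⟩
  · refine hcol D (by exact_mod_cast hD) ?_ fun x hx y hy => by rw [hmono x hx, hmono y hy]
    exact fun x hx y hy => Relation.ReflTransGen.mono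
      (fun _ _ h => ⟨Or.inl h.1, h.2⟩) _ _ (hDc x hx y hy)
  · obtain ⟨h1, h2⟩ := hDc.joinedVia hdisj (by rw [← Finset.coe_union]; exact Finset.coe_subset.2 hD)
    have hE : (D ∩ R).card ≤ forcedBound k Δ m := by
      refine hcol (D ∩ R) (by exact_mod_cast Finset.inter_subset_right) (by exact_mod_cast h1) ?_
      intro x hx y hy
      rw [Finset.mem_inter] at hx hy
      rw [hmono x hx.1 hx.2, hmono y hy.1 hy.2]
    rcases (D ∩ R).eq_empty_or_nonempty with he | hne
    · have : D.card ≤ m := by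
        refine hK D (fun x hx => ?_) hDc
        refine (Finset.mem_union.1 (hD hx)).resolve_left fun hxR => ?_
        have : x ∈ D ∩ R := Finset.mem_inter.2 ⟨hx, hxR⟩
        simp [he] at this
      omega
    · obtain ⟨B, hB, hBc⟩ := hull (D ∩ R)
      have hsub : D ⊆ D ∩ R ∪ B := by
        intro y hy
        rcases h2 (by exact_mod_cast hne) hy with h | ⟨x, hx, a, ha, hxa, hay⟩
        · exact Finset.mem_union_left _ (by exact_mod_cast h)
        · exact Finset.mem_union_right _ ((hB y).2 ⟨x, by exact_mod_cast hx, a, ha, hxa, hay⟩)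
      have h3 := (Finset.card_le_card hsub).trans (Finset.card_union_le _ _)
      have h4 := Nat.mul_le_mul_right m (Nat.mul_le_mul_right Δ hE)
      omega

/-- The bound on the clusters of the three-colouring in `exists_clustered_three_coloring`. -/
def threeColourBound (k Δ : ℕ) : ℕ :=
  clusterBound k Δ + forcedBound k Δ (clusterBound k Δ)
    + forcedBound k Δ (clusterBound k Δ) * Δ * clusterBound k Δ

/-- If two sets `Y₁`, `Y₂` with bounded covers overlap so much that there are no edges between
their complements, then there is a three-colouring with bounded clusters. The colour `0` is given
to half of a clustered two-colouring of `Y₁`; the other half, of bounded components, gets the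
colour `1` inside `Y₂` and the colour `2` outside, so that only the colour `1` interferes with the
colouring of the complement of `Y₁` by the colours `1` and `2`. -/
theorem exists_clustered_three_coloring [DecidableRel r] (hr : ∀ a b, r a b → r b a)
    (hΔ : ∀ v, (Finset.univ.filter (r v)).card ≤ Δ) {Y₁ Y₂ : Finset V}
    (hY : ∀ v, v ∈ Y₁ ∨ v ∈ Y₂) (hedge : ∀ a b, r a b → a ∈ Y₁ ∨ b ∈ Y₂)
    (h₁ : HasCover r (Y₁ : Set V) k) (h₂ : HasCover r (Y₂ : Set V) k) :
    ∃ col : V → Fin 3, Clustered r Set.univ col (threeColourBound k Δ) := by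
  obtain ⟨e, he⟩ := exists_clustered_coloring hr hΔ h₁
  let K : Finset V := Y₂.filter fun v => v ∈ Y₁ ∧ e v = false
  have hKmem : ∀ v, v ∈ K ↔ v ∈ Y₂ ∧ v ∈ Y₁ ∧ e v = false := by simp [K]
  have hRK : Disjoint Y₁ᶜ K := by
    rw [Finset.disjoint_left]
    intro v hv hvK
    exact (Finset.mem_compl.1 hv) ((hKmem v).1 hvK).2.1
  have hcov : HasCover r (↑(Y₁ᶜ ∪ K) : Set V) k := by
    intro F hF hFF
    refine h₂ F (fun D hD => ⟨fun v hv => ?_, (hF D hD).2⟩) hFF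
    have hv' : v ∈ Y₁ᶜ ∪ K := by exact_mod_cast (hF D hD).1 hv
    rcases Finset.mem_union.1 hv' with h | h
    · exact_mod_cast (hY v).resolve_left (Finset.mem_compl.1 h)
    · exact_mod_cast ((hKmem v).1 h).1
  obtain ⟨c, hc₁, hc₂⟩ := exists_clustered_coloring_forced hr hΔ hRK hcov
    (m := clusterBound k Δ) fun D hDK hDc => he D
      (fun v hv => by exact_mod_cast ((hKmem v).1 (hDK hv)).2.1) hDc fun x hx y hy => by
        rw [((hKmem x).1 (hDK hx)).2.2, ((hKmem y).1 (hDK hy)).2.2]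
  let col : V → Fin 3 := fun v =>
    if v ∈ Y₁ then (if e v = true then 0 else if v ∈ Y₂ then 1 else 2)
    else (if c v = true then 1 else 2)
  have hcol0 : ∀ v, col v = 0 → v ∈ Y₁ ∧ e v = true := by
    intro v hv
    simp only [col] at hv
    split_ifs at hv <;> simp_all
  have hcol1 : ∀ v, col v = 1 → v ∈ Y₁ᶜ ∪ K ∧ (v ∈ Y₁ᶜ → c v = true) := by
    intro v hv
    rw [Finset.mem_union, hKmem, Finset.mem_compl]
    simp only [col] at hv
    split_ifs at hv <;> simp_all
  have hcol2 : ∀ v, col v = 2 → (v ∈ Y₁ ∧ v ∉ Y₂ ∧ e v = false) ∨ (v ∉ Y₁ ∧ c v = false) := by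
    intro v hv
    simp only [col] at hv
    split_ifs at hv <;> simp_all
  refine ⟨col, fun D _ hDc hmono => ?_⟩
  unfold threeColourBound
  rcases D.eq_empty_or_nonempty with rfl | ⟨x, hx⟩
  · simp
  obtain h | h | h : col x = 0 ∨ col x = 1 ∨ col x = 2 := by
    generalize col x = i
    fin_cases i <;> simp
  · have hD : ∀ y ∈ D, y ∈ Y₁ ∧ e y = true := fun y hy => hcol0 y ((hmono y hy x hx).trans h)
    have := he D (fun y hy => by exact_mod_cast (hD y hy).1) hDc fun y hy z hz => by
      rw [(hD y hy).2, (hD z hz).2]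
    omega
  · have hD := fun y (hy : y ∈ D) => hcol1 y ((hmono y hy x hx).trans h)
    have := hc₂ D (fun y hy => (hD y hy).1) hDc fun y hy => (hD y hy).2
    omega
  · have hD := fun y (hy : y ∈ D) => hcol2 y ((hmono y hy x hx).trans h)
    by_cases hDY : ∃ y ∈ D, y ∉ Y₁
    · obtain ⟨y, hy, hyY⟩ := hDY
      have hsub : (D : Set V) ⊆ (Y₁ : Set V)ᶜ := by
        refine hDc.subset_of_closed ⟨y, hy, by simpa using hyY⟩ fun a ha _ b hb hab => ?_
        have hbY := (hedge a b hab).resolve_left (by simpa using ha)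
        rcases hD b hb with h | h
        · exact absurd hbY h.2.1
        · simpa using h.1
      have hsub' : ∀ y ∈ D, y ∉ Y₁ := fun y hy => by simpa using hsub hy
      have := hc₁ D (fun y hy => Finset.mem_compl.2 (hsub' y hy)) hDc fun y hy =>
        ((hD y hy).resolve_left fun h => hsub' y hy h.1).2
      omega
    · push Not at hDY
      have hD' : ∀ y ∈ D, e y = false := fun y hy =>
        ((hD y hy).resolve_right fun h => h.1 (hDY y hy)).2.2
      have := he D (fun y hy => by exact_mod_cast hDY y hy) hDc fun y hy z hz => by
        rw [hD' y hy, hD' z hz]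
      omega

end Forced

/-! ### The Hex theorem for the cube -/

/-- The indicator, modulo 2, of the label triples that form `{1, 2, 3}`. -/
def rainbow (a b c : Fin 4) : ZMod 2 :=
  if a ≠ 0 ∧ b ≠ 0 ∧ c ≠ 0 ∧ a ≠ b ∧ a ≠ c ∧ b ≠ c then 1 else 0

/-- A tetrahedron has an odd number of faces labelled `{1, 2, 3}` only if it has all labels. -/
theorem rainbow_faces : ∀ a b c d : Fin 4,
    ¬ (a ≠ b ∧ a ≠ c ∧ a ≠ d ∧ b ≠ c ∧ b ≠ d ∧ c ≠ d) →
      rainbow b c d + rainbow a c d + rainbow a b d + rainbow a b c = 0 := by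
  decide

theorem rainbow_eq_zero_of_ne : ∀ l : Fin 4, l ≠ 0 → ∀ a b c : Fin 4,
    a ≠ l → b ≠ l → c ≠ l → rainbow a b c = 0 := by
  decide

/-- A telescoping sum modulo 2. -/
theorem sum_range_add_succ_zmod_two (f : ℕ → ZMod 2) (n : ℕ) :
    ∑ i ∈ Finset.range n, (f i + f (i + 1)) = f 0 + f n := by
  induction n with
  | zero => simp [CharTwo.add_self_eq_zero]
  | succ n ih =>
    rw [Finset.sum_range_succ, ih]
    linear_combination CharTwo.add_self_eq_zero (f n)

/-- `q` is obtained from `p` by increasing some coordinates by one. -/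
def IsMonotoneStep (p q : ℕ × ℕ × ℕ) : Prop :=
  (p.1 ≤ q.1 ∧ q.1 ≤ p.1 + 1) ∧ (p.2.1 ≤ q.2.1 ∧ q.2.1 ≤ p.2.1 + 1) ∧
    (p.2.2 ≤ q.2.2 ∧ q.2.2 ≤ p.2.2 + 1)

/-- A parity version of Sperner's lemma for the cube `[0, N]³`, triangulated by the monotone
diagonals of its unit cubes. The label `i` is given to the points with `i`-th coordinate `0` (with
precedence for the smaller `i`) and not to points with `i`-th coordinate `N`. Then some tetrahedron
has all labels: otherwise, the number of boundary triangles labelled `{1, 2, 3}` would be even,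
while there is just one, next to the origin. -/
theorem exists_rainbow_tetrahedron {N : ℕ} (hN : 0 < N) (g : ℕ → ℕ → ℕ → Fin 4)
    (hx0 : ∀ y z, g 0 y z = 1) (hy0 : ∀ x z, x ≠ 0 → g x 0 z = 2)
    (hz0 : ∀ x y, x ≠ 0 → y ≠ 0 → g x y 0 = 3)
    (hxN : ∀ y z, g N y z ≠ 1) (hyN : ∀ x z, g x N z ≠ 2) (hzN : ∀ x y, g x y N ≠ 3) :
    ∃ p : Fin 4 → ℕ × ℕ × ℕ, (∀ i j, i < j → IsMonotoneStep (p i) (p j)) ∧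
      Function.Injective fun i => g (p i).1 (p i).2.1 (p i).2.2 := by
  by_contra hno
  have tet : ∀ p : Fin 4 → ℕ × ℕ × ℕ, (∀ i j, i < j → IsMonotoneStep (p i) (p j)) →
      ∀ a b c d, g (p 0).1 (p 0).2.1 (p 0).2.2 = a → g (p 1).1 (p 1).2.1 (p 1).2.2 = b →
        g (p 2).1 (p 2).2.1 (p 2).2.2 = c → g (p 3).1 (p 3).2.1 (p 3).2.2 = d →
        rainbow b c d + rainbow a c d + rainbow a b d + rainbow a b c = 0 := by
    intro p hp a b c d ha hb hc hd
    refine rainbow_faces a b c d fun h => hno ⟨p, hp, fun i j hij => ?_⟩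
    fin_cases i <;> fin_cases j <;> simp_all
  have step : ∀ x y z a b c a' b' c' : ℕ, a ≤ a' → a' ≤ a + 1 → b ≤ b' → b' ≤ b + 1 → c ≤ c' →
      c' ≤ c + 1 → IsMonotoneStep (x + a, y + b, z + c) (x + a', y + b', z + c') := by
    intro x y z a b c a' b' c' _ _ _ _ _ _
    refine ⟨⟨?_, ?_⟩, ⟨?_, ?_⟩, ⟨?_, ?_⟩⟩ <;> dsimp only <;> omega
  have tet' : ∀ x y z a b c a' b' c' : ℕ, a ≤ a' → a' ≤ 1 → b ≤ b' → b' ≤ 1 → c ≤ c' → c' ≤ 1 →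
      rainbow (g (x + a) (y + b) (z + c)) (g (x + a') (y + b') (z + c'))
          (g (x + 1) (y + 1) (z + 1))
        + rainbow (g x y z) (g (x + a') (y + b') (z + c')) (g (x + 1) (y + 1) (z + 1))
        + rainbow (g x y z) (g (x + a) (y + b) (z + c)) (g (x + 1) (y + 1) (z + 1))
        + rainbow (g x y z) (g (x + a) (y + b) (z + c)) (g (x + a') (y + b') (z + c')) = 0 := by
    intro x y z a b c a' b' c' ha ha' hb hb' hc hc'
    refine tet ![(x + 0, y + 0, z + 0), (x + a, y + b, z + c), (x + a', y + b', z + c'),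
      (x + 1, y + 1, z + 1)] ?_ _ _ _ _ rfl rfl rfl rfl
    intro i j hij
    fin_cases i <;> fin_cases j <;> first
      | exact absurd hij (by decide)
      | (refine step x y z _ _ _ _ _ _ ?_ ?_ ?_ ?_ ?_ ?_ <;> omega)
  -- the two triangles of a unit square perpendicular to each of the three axes
  let X : ℕ → ℕ → ℕ → ZMod 2 := fun y z x =>
    rainbow (g x y z) (g x (y + 1) z) (g x (y + 1) (z + 1))
      + rainbow (g x y z) (g x y (z + 1)) (g x (y + 1) (z + 1))
  let Y : ℕ → ℕ → ℕ → ZMod 2 := fun x z y =>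
    rainbow (g x y z) (g (x + 1) y z) (g (x + 1) y (z + 1))
      + rainbow (g x y z) (g x y (z + 1)) (g (x + 1) y (z + 1))
  let Z : ℕ → ℕ → ℕ → ZMod 2 := fun x y z =>
    rainbow (g x y z) (g (x + 1) y z) (g (x + 1) (y + 1) z)
      + rainbow (g x y z) (g x (y + 1) z) (g (x + 1) (y + 1) z)
  have cube : ∀ x y z, (X y z x + X y z (x + 1)) + (Y x z y + Y x z (y + 1))
      + (Z x y z + Z x y (z + 1)) = 0 := by
    intro x y z
    have two : (2 : ZMod 2) = 0 := by decide
    have h1 := tet' x y z 1 0 0 1 1 0 (by omega) (by omega) (by omega) (by omega) (by omega)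
      (by omega)
    have h2 := tet' x y z 1 0 0 1 0 1 (by omega) (by omega) (by omega) (by omega) (by omega)
      (by omega)
    have h3 := tet' x y z 0 1 0 1 1 0 (by omega) (by omega) (by omega) (by omega) (by omega)
      (by omega)
    have h4 := tet' x y z 0 1 0 0 1 1 (by omega) (by omega) (by omega) (by omega) (by omega)
      (by omega)
    have h5 := tet' x y z 0 0 1 1 0 1 (by omega) (by omega) (by omega) (by omega) (by omega)
      (by omega)
    have h6 := tet' x y z 0 0 1 0 1 1 (by omega) (by omega) (by omega) (by omega) (by omega)
      (by omega)
    simp only [Nat.add_zero] at h1 h2 h3 h4 h5 h6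
    -- the triangles inside the cube contain its diagonal, and lie in two tetrahedra each
    let I : Fin 4 → ZMod 2 := fun v => rainbow (g x y z) v (g (x + 1) (y + 1) (z + 1))
    simp only [X, Y, Z]
    linear_combination h1 + h2 + h3 + h4 + h5 + h6
      - two * (I (g (x + 1) y z) + I (g x (y + 1) z) + I (g x y (z + 1)) +
        I (g (x + 1) (y + 1) z) + I (g (x + 1) y (z + 1)) + I (g x (y + 1) (z + 1)))
  have zero : ∀ l : Fin 4, l ≠ 0 → ∀ a b c d : Fin 4, a ≠ l → b ≠ l → c ≠ l → d ≠ l →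
      rainbow a b d + rainbow a c d = 0 := by
    intro l hl a b c d ha hb hc hd
    rw [rainbow_eq_zero_of_ne l hl a b d ha hb hd, rainbow_eq_zero_of_ne l hl a c d ha hc hd,
      add_zero]
  have hX0 : ∀ y z, X y z 0 = 0 := fun y z =>
    zero 2 (by decide) _ _ _ _ (by simp [hx0]) (by simp [hx0]) (by simp [hx0]) (by simp [hx0])
  have hXN : ∀ y z, X y z N = 0 := fun y z => zero 1 (by decide) _ _ _ _ (hxN _ _) (hxN _ _)
    (hxN _ _) (hxN _ _)
  have hY0' : ∀ x z, g x 0 z ≠ 3 := by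
    intro x z
    rcases eq_or_ne x 0 with rfl | hx
    · simp [hx0]
    · simp [hy0 x z hx]
  have hY0 : ∀ x z, Y x z 0 = 0 := fun x z => zero 3 (by decide) _ _ _ _ (hY0' _ _) (hY0' _ _)
    (hY0' _ _) (hY0' _ _)
  have hYN : ∀ x z, Y x z N = 0 := fun x z => zero 2 (by decide) _ _ _ _ (hyN _ _) (hyN _ _)
    (hyN _ _) (hyN _ _)
  have hZN : ∀ x y, Z x y N = 0 := fun x y => zero 3 (by decide) _ _ _ _ (hzN _ _) (hzN _ _)
    (hzN _ _) (hzN _ _)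
  have hZ0 : ∀ x y, Z x y 0 = if x = 0 ∧ y = 0 then 1 else 0 := by
    intro x y
    rcases x with _ | x <;> rcases y with _ | y <;> simp [Z, hx0, hy0, hz0] <;> decide
  have total : ∑ x ∈ Finset.range N, ∑ y ∈ Finset.range N, ∑ z ∈ Finset.range N,
      ((X y z x + X y z (x + 1)) + (Y x z y + Y x z (y + 1)) + (Z x y z + Z x y (z + 1))) = 0 := by
    simp only [cube, Finset.sum_const_zero]
  have e1 : ∑ x ∈ Finset.range N, ∑ y ∈ Finset.range N, ∑ z ∈ Finset.range N,
      (X y z x + X y z (x + 1)) = 0 := by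
    rw [Finset.sum_comm]
    refine Finset.sum_eq_zero fun y _ => ?_
    rw [Finset.sum_comm]
    refine Finset.sum_eq_zero fun z _ => ?_
    rw [sum_range_add_succ_zmod_two, hX0, hXN, add_zero]
  have e2 : ∑ x ∈ Finset.range N, ∑ y ∈ Finset.range N, ∑ z ∈ Finset.range N,
      (Y x z y + Y x z (y + 1)) = 0 := by
    refine Finset.sum_eq_zero fun x _ => ?_
    rw [Finset.sum_comm]
    refine Finset.sum_eq_zero fun z _ => ?_
    rw [sum_range_add_succ_zmod_two, hY0, hYN, add_zero]
  have e3 : ∑ x ∈ Finset.range N, ∑ y ∈ Finset.range N, ∑ z ∈ Finset.range N,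
      (Z x y z + Z x y (z + 1)) = 1 := by
    simp only [sum_range_add_succ_zmod_two, hZ0, hZN, add_zero, ite_and]
    simp [Finset.sum_ite_eq', hN]
  have split : ∑ x ∈ Finset.range N, ∑ y ∈ Finset.range N, ∑ z ∈ Finset.range N,
      ((X y z x + X y z (x + 1)) + (Y x z y + Y x z (y + 1)) + (Z x y z + Z x y (z + 1)))
        = ∑ x ∈ Finset.range N, ∑ y ∈ Finset.range N, ∑ z ∈ Finset.range N,
            (X y z x + X y z (x + 1))
          + ∑ x ∈ Finset.range N, ∑ y ∈ Finset.range N, ∑ z ∈ Finset.range N,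
            (Y x z y + Y x z (y + 1))
          + ∑ x ∈ Finset.range N, ∑ y ∈ Finset.range N, ∑ z ∈ Finset.range N,
            (Z x y z + Z x y (z + 1)) := by
    simp only [← Finset.sum_add_distrib]
  rw [total, e1, e2, e3] at split
  exact absurd split (by decide)

/-- The adjacency relation of `cubeGraph`, made reflexive. -/
def cubeNear (N : ℕ) (p q : Fin N × Fin N × Fin N) : Prop :=
  cubeStep N p q ∨ cubeStep N q p

theorem cubeNear.symm {N : ℕ} (p q : Fin N × Fin N × Fin N) (h : cubeNear N p q) :
    cubeNear N q p :=
  Or.symm h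

/-- The `i`-th coordinate of a triple. -/
def tripleCoord {α : Type*} (i : Fin 3) (p : α × α × α) : α :=
  ![p.1, p.2.1, p.2.2] i

theorem cubeNear.tripleCoord_le {N : ℕ} {p q : Fin N × Fin N × Fin N} (h : cubeNear N p q)
    (i : Fin 3) : (tripleCoord i q).val ≤ (tripleCoord i p).val + 1 := by
  unfold cubeNear cubeStep at h
  fin_cases i <;> simp only [tripleCoord] <;> rcases h with h | h <;> simp <;> omega

/-- A connected set that meets both faces in some direction has at least `N` points, since every
value of the coordinate occurs. -/
theorem le_card_of_connOn_cubeNear {N : ℕ} {D : Finset (Fin N × Fin N × Fin N)}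
    (hD : ConnOn (cubeNear N) (D : Set (Fin N × Fin N × Fin N))) (i : Fin 3)
    {p q : Fin N × Fin N × Fin N} (hp : p ∈ D) (hq : q ∈ D) (hp0 : (tripleCoord i p).val = 0)
    (hqN : (tripleCoord i q).val + 1 = N) : N ≤ D.card := by
  classical
  have key : ∀ k ≤ (tripleCoord i q).val, ∃ x ∈ D, (tripleCoord i x).val = k := by
    have h := hD p hp q hq
    clear hqN hq
    induction h with
    | refl => exact fun k hk => ⟨p, hp, by omega⟩
    | @tail b c _ hbc ih =>
      intro k hk
      have h1 := hbc.1.tripleCoord_le i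
      by_cases hkb : k ≤ (tripleCoord i b).val
      · exact ih k hkb
      · exact ⟨c, by exact_mod_cast hbc.2.2, by omega⟩
  have hsub : Finset.range N ⊆ D.image fun x => (tripleCoord i x).val := by
    intro k hk
    obtain ⟨x, hx, hxk⟩ := key k (by have := Finset.mem_range.1 hk; omega)
    exact Finset.mem_image.2 ⟨x, hx, hxk⟩
  simpa using (Finset.card_le_card hsub).trans Finset.card_image_le

/-- The Hex theorem: in a three-colouring of the cube some colour connects opposite faces. If not,
label the points of colour `i` that are connected within their colour to the face where the `i`-th
coordinate is smallest by `i + 1`, and the other points by `0`; after an additional layer is put on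
these three faces, this contradicts Sperner's lemma. -/
theorem exists_large_cluster {N : ℕ} (hN : 0 < N) (χ : Fin N × Fin N × Fin N → Fin 3) :
    ∃ D : Finset (Fin N × Fin N × Fin N), ConnOn (cubeNear N) (D : Set (Fin N × Fin N × Fin N)) ∧
      (∀ x ∈ D, ∀ y ∈ D, χ x = χ y) ∧ N ≤ D.card := by
  classical
  by_contra! hno
  let U : Fin N × Fin N × Fin N → Prop := fun p => ∃ q, χ q = χ p ∧
    (tripleCoord (χ p) q).val = 0 ∧ Linked (cubeNear N) {x | χ x = χ p} q p
  have hU : ∀ p, U p → (tripleCoord (χ p) p).val + 1 ≠ N := by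
    rintro p ⟨q, hq, hq0, hqp⟩ hpN
    let D : Finset (Fin N × Fin N × Fin N) :=
      Finset.univ.filter fun x => Linked (cubeNear N) {x | χ x = χ p} q x
    have hDc : ConnOn (cubeNear N) (D : Set (Fin N × Fin N × Fin N)) := by
      convert connOn_setOf_linked cubeNear.symm {x | χ x = χ p} q using 1
      ext; simp [D]
    have hDχ : ∀ x ∈ D, χ x = χ p := fun x hx => (Finset.mem_filter.1 hx).2.mem hq
    have hlt := hno D hDc fun x hx y hy => (hDχ x hx).trans (hDχ y hy).symm
    have := le_card_of_connOn_cubeNear hDc (χ p) (p := q) (q := p)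
      (Finset.mem_filter.2 ⟨Finset.mem_univ _, .refl⟩) (by simpa [D] using hqp) hq0 hpN
    omega
  -- the point of the cube next to a point of the enlarged grid
  let clamp : ℕ → Fin N := fun k => ⟨min (k - 1) (N - 1), by omega⟩
  let c : ℕ × ℕ × ℕ → Fin N × Fin N × Fin N := fun p => (clamp p.1, clamp p.2.1, clamp p.2.2)
  have hc : ∀ p q, IsMonotoneStep p q → cubeStep N (c p) (c q) := by
    rintro p q ⟨⟨_, _⟩, ⟨_, _⟩, ⟨_, _⟩⟩
    refine ⟨⟨?_, ?_⟩, ⟨?_, ?_⟩, ⟨?_, ?_⟩⟩ <;> simp only [c, clamp] <;> omega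
  have hcc : ∀ i p, (tripleCoord i (c p)).val = min (tripleCoord i p - 1) (N - 1) := by
    intro i p
    fin_cases i <;> rfl
  let g : ℕ → ℕ → ℕ → Fin 4 := fun x y z =>
    if x = 0 then 1 else if y = 0 then 2 else if z = 0 then 3
    else if U (c (x, y, z)) then (χ (c (x, y, z))).succ else 0
  have hg : ∀ p : ℕ × ℕ × ℕ, ∀ j : Fin 3, g p.1 p.2.1 p.2.2 = j.succ →
      tripleCoord j p = 0 ∨ ((∀ i, tripleCoord i p ≠ 0) ∧ U (c p) ∧ χ (c p) = j) := by
    rintro ⟨x, y, z⟩ j h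
    simp only [g] at h
    split_ifs at h with h1 h2 h3 h4
    · left; obtain rfl : j = 0 := Fin.succ_injective _ h.symm
      simpa [tripleCoord] using h1
    · left; obtain rfl : j = 1 := Fin.succ_injective _ h.symm
      simpa [tripleCoord] using h2
    · left; obtain rfl : j = 2 := Fin.succ_injective _ h.symm
      simpa [tripleCoord] using h3
    · refine Or.inr ⟨fun i => ?_, h4, Fin.succ_injective _ h⟩
      fin_cases i <;> simpa [tripleCoord]
    · exact absurd h.symm (Fin.succ_ne_zero j)
  have hg0 : ∀ p : ℕ × ℕ × ℕ, g p.1 p.2.1 p.2.2 = 0 →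
      (∀ i, tripleCoord i p ≠ 0) ∧ ¬ U (c p) := by
    rintro ⟨x, y, z⟩ h
    simp only [g] at h
    split_ifs at h with h1 h2 h3 h4
    · exact absurd h (by decide)
    · exact absurd h (by decide)
    · exact absurd h (by decide)
    · exact absurd h (Fin.succ_ne_zero _)
    · refine ⟨fun i => ?_, h4⟩
      fin_cases i <;> simpa [tripleCoord]
  have hgN : ∀ p : ℕ × ℕ × ℕ, ∀ j : Fin 3, tripleCoord j p = N → g p.1 p.2.1 p.2.2 ≠ j.succ := by
    intro p j hj h
    rcases hg p j h with h | ⟨-, h', rfl⟩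
    · omega
    · exact hU _ h' (by rw [hcc, hj]; omega)
  obtain ⟨p, hp, hinj⟩ := exists_rainbow_tetrahedron hN g (fun y z => by simp [g])
    (fun x z hx => by simp [g, hx]) (fun x y hx hy => by simp [g, hx, hy])
    (fun y z => hgN (N, y, z) 0 rfl) (fun x z => hgN (x, N, z) 1 rfl)
    (fun x y => hgN (x, y, N) 2 rfl)
  have hsurj := Finite.injective_iff_surjective.1 hinj
  obtain ⟨a, ha⟩ := hsurj 0
  obtain ⟨ha0, haU⟩ := hg0 (p a) ha
  obtain ⟨b, hb⟩ := hsurj (χ (c (p a))).succ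
  have hstep : IsMonotoneStep (p a) (p b) ∨ IsMonotoneStep (p b) (p a) := by
    rcases lt_trichotomy a b with h | h | h
    · exact Or.inl (hp _ _ h)
    · subst h
      exact absurd (hb.symm.trans ha) (Fin.succ_ne_zero _)
    · exact Or.inr (hp _ _ h)
  rcases hg (p b) _ hb with h | ⟨-, ⟨q, hq, hq0, hqb⟩, hχ⟩
  · refine haU ⟨c (p a), rfl, ?_, .refl⟩
    have h1 := ha0 (χ (c (p a)))
    rw [hcc]
    have h2 : tripleCoord (χ (c (p a))) (p a) ≤ tripleCoord (χ (c (p a))) (p b) + 1 := by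
      generalize χ (c (p a)) = i
      unfold IsMonotoneStep at hstep
      fin_cases i <;> simp only [tripleCoord] <;> rcases hstep with h | h <;> simp <;> omega
    omega
  · rw [hχ] at hq hq0 hqb
    refine haU ⟨q, hq, hq0, hqb.tail ⟨?_, hχ, rfl⟩⟩
    exact hstep.symm.imp (hc _ _) (hc _ _)

/-! ### Refining the cube -/

/-- The `θ`-th rounding of the points of the cube of side `3n - 2` to the cube of side `n`. For a
point `p` and varying `θ`, the roundings form a monotone chain of vertices of a unit cube around
`p / 3`. -/
def rounding (n : ℕ) (θ : Fin 3) (p : Fin (3 * n - 2) × Fin (3 * n - 2) × Fin (3 * n - 2)) :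
    Fin n × Fin n × Fin n :=
  (⟨(p.1 + θ) / 3, by omega⟩, ⟨(p.2.1 + θ) / 3, by omega⟩, ⟨(p.2.2 + θ) / 3, by omega⟩)

/-- All the roundings of two adjacent points form a clique. -/
theorem cubeNear_rounding {n : ℕ} {p q : Fin (3 * n - 2) × Fin (3 * n - 2) × Fin (3 * n - 2)}
    (h : cubeNear (3 * n - 2) p q) (θ θ' : Fin 3) :
    cubeNear n (rounding n θ p) (rounding n θ' q) := by
  have key : ∀ p q, cubeStep (3 * n - 2) p q → ∀ θ θ' : Fin 3,
      cubeNear n (rounding n θ p) (rounding n θ' q) := by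
    rintro p q ⟨⟨_, _⟩, ⟨_, _⟩, ⟨_, _⟩⟩ θ θ'
    rcases le_or_gt θ.val θ'.val with hθ | hθ
    · left
      refine ⟨⟨?_, ?_⟩, ⟨?_, ?_⟩, ⟨?_, ?_⟩⟩ <;> simp only [rounding] <;> omega
    · right
      refine ⟨⟨?_, ?_⟩, ⟨?_, ?_⟩, ⟨?_, ?_⟩⟩ <;> simp only [rounding] <;> omega
  rcases h with h | h
  · exact key p q h θ θ'
  · exact (key q p h θ' θ).symm

theorem sum_lt_of_le_of_ne {n : ℕ} {a b : Fin n × Fin n × Fin n} (h1 : a.1 ≤ b.1)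
    (h2 : a.2.1 ≤ b.2.1) (h3 : a.2.2 ≤ b.2.2) (h : a ≠ b) :
    (a.1 : ℕ) + a.2.1 + a.2.2 < b.1 + b.2.1 + b.2.2 := by
  by_contra! hle
  rw [Fin.le_def] at h1 h2 h3
  refine h (Prod.ext (Fin.ext ?_) (Prod.ext (Fin.ext ?_) (Fin.ext ?_))) <;> omega

/-- Two adjacent points have a common rounding: the six roundings alternate in a monotone chain,
and a unit cube has no chain of more than four vertices. -/
theorem exists_rounding_eq {n : ℕ} {p q : Fin (3 * n - 2) × Fin (3 * n - 2) × Fin (3 * n - 2)}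
    (h : cubeNear (3 * n - 2) p q) : ∃ θ θ', rounding n θ p = rounding n θ' q := by
  have key : ∀ p q, cubeStep (3 * n - 2) p q → ∃ θ θ', rounding n θ p = rounding n θ' q := by
    rintro p q ⟨⟨_, _⟩, ⟨_, _⟩, ⟨_, _⟩⟩
    by_contra! hne
    have h1 := sum_lt_of_le_of_ne (a := rounding n 0 p) (b := rounding n 0 q)
      (by simp [rounding]; omega) (by simp [rounding]; omega) (by simp [rounding]; omega) (hne _ _)
    have h2 := sum_lt_of_le_of_ne (a := rounding n 0 q) (b := rounding n 1 p)
      (by simp [rounding]; omega) (by simp [rounding]; omega) (by simp [rounding]; omega)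
      (hne _ _).symm
    have h3 := sum_lt_of_le_of_ne (a := rounding n 1 p) (b := rounding n 1 q)
      (by simp [rounding]; omega) (by simp [rounding]; omega) (by simp [rounding]; omega) (hne _ _)
    have h4 := sum_lt_of_le_of_ne (a := rounding n 1 q) (b := rounding n 2 p)
      (by simp [rounding]; omega) (by simp [rounding]; omega) (by simp [rounding]; omega)
      (hne _ _).symm
    have h5 : ((rounding n 2 p).1 : ℕ) + (rounding n 2 p).2.1 + (rounding n 2 p).2.2
        ≤ (rounding n 0 p).1 + (rounding n 0 p).2.1 + (rounding n 0 p).2.2 + 3 := by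
      simp [rounding]; omega
    omega
  rcases h with h | h
  · exact key p q h
  · obtain ⟨θ, θ', h⟩ := key q p h
    exact ⟨θ', θ, h.symm⟩

theorem card_box_le {N m : ℕ} (a b c : ℕ) (S : Finset (Fin N × Fin N × Fin N))
    (hS : ∀ p ∈ S, (a ≤ p.1 ∧ (p.1 : ℕ) < a + m) ∧ (b ≤ p.2.1 ∧ (p.2.1 : ℕ) < b + m) ∧
      (c ≤ p.2.2 ∧ (p.2.2 : ℕ) < c + m)) : S.card ≤ m * (m * m) := by
  have : S.card ≤ (Finset.Ico a (a + m) ×ˢ Finset.Ico b (b + m) ×ˢ Finset.Ico c (c + m)).card := by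
    refine Finset.card_le_card_of_injOn (fun p => ((p.1 : ℕ), (p.2.1 : ℕ), (p.2.2 : ℕ))) ?_ ?_
    · intro p hp
      simpa using hS p hp
    · rintro ⟨x, y, z⟩ _ ⟨x', y', z'⟩ _ h
      simpa [Fin.ext_iff] using h
  simpa using this

theorem card_cubeNear_le (N : ℕ) [DecidableRel (cubeNear N)] (p : Fin N × Fin N × Fin N) :
    (Finset.univ.filter (cubeNear N p)).card ≤ 27 := by
  refine card_box_le (m := 3) (p.1 - 1) (p.2.1 - 1) (p.2.2 - 1) _ fun q hq => ?_
  have h := (Finset.mem_filter.1 hq).2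
  unfold cubeNear cubeStep at h
  rcases h with ⟨⟨_, _⟩, ⟨_, _⟩, ⟨_, _⟩⟩ | ⟨⟨_, _⟩, ⟨_, _⟩, ⟨_, _⟩⟩ <;>
    refine ⟨⟨?_, ?_⟩, ⟨?_, ?_⟩, ⟨?_, ?_⟩⟩ <;> omega

theorem HasCover.of_induce {V : Type*} {G : SimpleGraph V} {A : Set V} {k : ℕ}
    (h : HasCover (G.induce A).Adj Set.univ k) : HasCover G.Adj A k := by
  classical
  intro F hF hFF
  have main := h ((fun D => ((↑) : A → V) ⁻¹' D) '' F) ?_ ?_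
  · obtain ⟨X, hXk, hX⟩ := main
    refine ⟨X.image (↑), Finset.card_image_le.trans hXk, fun D hD => ?_⟩
    obtain ⟨x, hx, hxD⟩ := hX _ ⟨D, hD, rfl⟩
    exact ⟨x, Finset.mem_image_of_mem _ hx, hxD⟩
  · rintro _ ⟨D, hD, rfl⟩
    obtain ⟨hDA, hDc⟩ := hF D hD
    refine ⟨Set.subset_univ _, ?_⟩
    rintro ⟨x, hxA⟩ hx ⟨y, hyA⟩ hy
    have key : ∀ z, Linked G.Adj D x z → ∀ hz : z ∈ A,
        Linked (G.induce A).Adj (((↑) : A → V) ⁻¹' D) ⟨x, hxA⟩ ⟨z, hz⟩ := by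
      intro z h
      induction h with
      | refl => exact fun _ => .refl
      | tail _ hbc ih => exact fun _ => .tail (ih (hDA hbc.2.1)) ⟨hbc.1, hbc.2.1, hbc.2.2⟩
    exact key y (hDc x hx y hy) hyA
  · rintro _ ⟨D, hD, rfl⟩ _ ⟨E, hE, rfl⟩
    obtain ⟨x, hxD, hxE⟩ := hFF D hD E hE
    exact ⟨⟨x, (hF D hD).1 hxD⟩, hxD, hxE⟩

/-- If the subgraph induced by `A` has small tree-width, then the points with some rounding in `A`
have small covers. -/
theorem hasCover_rounding {n t : ℕ} {A : Set (Fin n × Fin n × Fin n)}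
    (h : ((cubeGraph n).induce A).treewidth < t) :
    HasCover (cubeNear (3 * n - 2)) {p | ∃ θ, rounding n θ p ∈ A} (t * 125) := by
  classical
  have hcov := (SimpleGraph.hasCover_of_treewidth_lt _ h Set.univ).of_induce
  let f : Fin (3 * n - 2) × Fin (3 * n - 2) × Fin (3 * n - 2) → Fin n × Fin n × Fin n := fun p =>
    if hp : ∃ θ, rounding n θ p ∈ A then rounding n hp.choose p else rounding n 0 p
  have hf : ∀ p, ∃ θ, f p = rounding n θ p := by
    intro p
    by_cases hp : ∃ θ, rounding n θ p ∈ A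
    · exact ⟨_, dif_pos hp⟩
    · exact ⟨_, dif_neg hp⟩
  refine hcov.comap f ?_ ?_ ?_
  · rintro p hp
    have : f p = rounding n (Exists.choose hp) p := dif_pos hp
    rw [this]
    exact Exists.choose_spec hp
  · intro p _ q _ hpq
    obtain ⟨θ, hθ⟩ := hf p
    obtain ⟨θ', hθ'⟩ := hf q
    rw [hθ, hθ']
    by_cases he : rounding n θ p = rounding n θ' q
    · exact Or.inl he
    · exact Or.inr ⟨he, cubeNear_rounding hpq θ θ'⟩
  · intro a
    refine card_box_le (m := 5) (3 * a.1 - 2) (3 * a.2.1 - 2) (3 * a.2.2 - 2) _ fun p hp => ?_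
    obtain ⟨θ, hθ⟩ := hf p
    have hpa : rounding n θ p = a := hθ.symm.trans (Finset.mem_filter.1 hp).2
    subst hpa
    refine ⟨⟨?_, ?_⟩, ⟨?_, ?_⟩, ⟨?_, ?_⟩⟩ <;> simp only [rounding] <;> omega

theorem theorem1 (t : ℕ) :
    ∃ n : ℕ, 1 ≤ n ∧
      ∀ A₁ A₂ : Set (Fin n × Fin n × Fin n), Disjoint A₁ A₂ → A₁ ∪ A₂ = Set.univ →
        (t : ℤ) ≤ ((cubeGraph n).induce A₁).treewidth ∨
        (t : ℤ) ≤ ((cubeGraph n).induce A₂).treewidth := by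
  classical
  obtain ⟨n, hn⟩ : ∃ n, n = threeColourBound (t * 125) 27 + 1 := ⟨_, rfl⟩
  refine ⟨n, by omega, fun A₁ A₂ hdisj hunion => ?_⟩
  by_contra! h
  have hmem : ∀ a, a ∈ A₁ ∨ a ∈ A₂ := fun a => by
    rw [← Set.mem_union, hunion]; trivial
  let Y : Set (Fin n × Fin n × Fin n) →
      Finset (Fin (3 * n - 2) × Fin (3 * n - 2) × Fin (3 * n - 2)) := fun A =>
    Finset.univ.filter fun p => ∃ θ, rounding n θ p ∈ A
  have hY : ∀ A p, p ∈ Y A ↔ ∃ θ, rounding n θ p ∈ A := by simp [Y]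
  have hcov : ∀ A, ((cubeGraph n).induce A).treewidth < t →
      HasCover (cubeNear (3 * n - 2)) (Y A : Set _) (t * 125) := by
    intro A hA
    convert hasCover_rounding hA using 1
    ext p
    simp [Y]
  have main := exists_clustered_three_coloring cubeNear.symm
    (fun p => card_cubeNear_le (3 * n - 2) p) (Y₁ := Y A₁) (Y₂ := Y A₂) ?_ ?_
    (hcov A₁ h.1) (hcov A₂ h.2)
  · obtain ⟨χ, hχ⟩ := main
    obtain ⟨D, hDc, hDχ, hDN⟩ := exists_large_cluster (N := 3 * n - 2) (by omega) χ
    have := hχ D (Set.subset_univ _) hDc hDχ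
    omega
  · intro p
    rw [hY, hY]
    exact (hmem (rounding n 0 p)).imp (fun h => ⟨0, h⟩) fun h => ⟨0, h⟩
  · intro p q hpq
    rw [hY, hY]
    obtain ⟨θ, θ', he⟩ := exists_rounding_eq hpq
    exact (hmem (rounding n θ p)).imp (fun h => ⟨θ, h⟩) fun h => ⟨θ', he ▸ h⟩
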